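/- Let $G$ be a compact Lie group with Lie algebra $\mathfrak g$, and let $h_0$ be a bi-invariant Riemannian metric on $G$. If $h$ and $h_0'$ are left-invariant metrics on $G$, there is a unique linear map $\Phi\colon\mathfrak g\to\mathfrak g$ with $h(X,Y)=h_0'(\Phi X,Y)$ for all $X,Y\in\mathfrak g$, called the matrix of $h$ with respect to $h_0'$. There is a unique linear $\Psi\colon\mathfrak g\to\mathfrak g$ (namely $\Psi=I-\Phi^{-1}$) such that the path $\Phi_t=(I-t\Psi)^{-1}$ satisfies $\Phi_1=\Phi$; this path is called the inverse-linear path from $h_0'$ to $h$. Let $h_t$ be the left-invariant metric with $h_t(X,Y)=h_0'(\Phi_tX,Y)$ for $X,Y\in\mathfrak g$, defined for those $t$ for which $I-t\Psi$ is invertible and this is an inner product on $\mathfrak g$ (in particular for $0\le t\le1$). For $X,Y\in\mathfrak g$ and such $t$, let $\kappa_{X,Y}(t)=h_t(R(U,V)V,U)$ be the unnormalized sectional curvature of $U=\Phi_t^{-1}X$ and $V=\Phi_t^{-1}Y$ with respect to $h_t$, where $R$ is the curvature tensor of $h_t$. The inverse-linear path from $h_0'$ to $h$ is called * nonnegative if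 $h_t$ has nonnegative sectional curvature for all $t\in[0,1]$; * locally nonnegative if there is $\varepsilon>0$ such that for all $X,Y\in\mathfrak g$ and all $t\in[0,\varepsilon)$, $\kappa_{X,Y}(t)$ is defined and $\kappa_{X,Y}(t)\ge0$; * infinitesimally nonnegative if for all $X,Y\in\mathfrak g$ there is $\varepsilon>0$ such that for all $t\in[0,\varepsilon)$, $\kappa_{X,Y}(t)$ is defined and $\kappa_{X,Y}(t)\ge0$. **Theorem.** Let $\lambda>0$ and let $h$ be any left-invariant metric on $G$. Then: 1. the inverse-linear path from $h_0$ to $h$ is nonnegative if and only if the inverse-linear path from $\lambda h_0$ to $h$ is nonnegative; 2. the inverse-linear path from $h_0$ to $h$ is locally nonnegative if and only if the inverse-linear path from $\lambda h_0$ to $h$ is locally nonnegative; 3. the inverse-linear path from $h_0$ to $h$ is infinitesimally nonnegative if and only if the inverse-linear path from $\lambda h_0$ to $h$ is infinitesimally nonnegative. -/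

import Mathlib

open Bundle VectorField
open scoped Manifold ContDiff

noncomputable section

namespace LeftInvariantCurvature

/-! ### Riemannian manifolds: Levi-Civita connection and curvature -/

section Manifold

variable {E : Type*} [NormedAddCommGroup E] [NormedSpace ℝ E] [FiniteDimensional ℝ E]
  {M : Type*} [TopologicalSpace M] [ChartedSpace E M] [IsManifold 𝓘(ℝ, E) ∞ M]

variable (E M) in
/-- Smooth Riemannian metrics on the manifold `M` (modelled on `E`, without boundary). -/
abbrev RMetric : Type _ :=
  ContMDiffRiemannianMetric 𝓘(ℝ, E) ∞ E (TangentSpace 𝓘(ℝ, E) : M → Type _)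

variable (E M) in
/-- Affine connections on `M`. For such a connection `D`, the value of `∇_X Y` at `x`
is `D Y x (X x)`. -/
abbrev Connection : Type _ :=
  CovariantDerivative 𝓘(ℝ, E) E (TangentSpace 𝓘(ℝ, E) : M → Type _)

/-- `D` is the Levi-Civita connection of `g`: it is torsion free, and
`X (g (Y, Z)) = g (∇_X Y, Z) + g (Y, ∇_X Z)`. -/
def IsLeviCivita (g : RMetric E M) (D : Connection E M) : Prop :=
  D.torsion = 0 ∧
  ∀ (x : M) (v : TangentSpace 𝓘(ℝ, E) x) (Y Z : Π p : M, TangentSpace 𝓘(ℝ, E) p),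
    MDiffAt (T% Y) x → MDiffAt (T% Z) x →
      d% (fun p ↦ g.inner p (Y p) (Z p)) x v =
        g.inner x (D Y x v) (Z x) + g.inner x (Y x) (D Z x v)

/-- The curvature operator `R(X, Y)Z = ∇_X ∇_Y Z - ∇_Y ∇_X Z - ∇_[X,Y] Z` at the point `x`. -/
def curvatureOperator (D : Connection E M) (X Y Z : Π p : M, TangentSpace 𝓘(ℝ, E) p) (x : M) :
    TangentSpace 𝓘(ℝ, E) x :=
  D (fun p ↦ D Z p (Y p)) x (X x) - D (fun p ↦ D Z p (X p)) x (Y x)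
    - D Z x (mlieBracket 𝓘(ℝ, E) X Y x)

open Classical in
/-- The unnormalized sectional curvature `g (R(X, Y)Y, X)` at `x` of the smooth vector fields
`X` and `Y`, computed with the Levi-Civita connection of `g`. (The Levi-Civita connection exists,
and its values on smooth vector fields are unique, so that the second branch is not used and the
choice in the first one does not matter.) -/
def unnormalizedSectionalCurvature (g : RMetric E M) (X Y : Π p : M, TangentSpace 𝓘(ℝ, E) p)
    (x : M) : ℝ :=
  if h : ∃ D : Connection E M, IsLeviCivita g D then
    g.inner x (curvatureOperator h.choose X Y Y x) (X x)
  else 0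

/-- `g` has nonnegative sectional curvature. -/
def IsNonnegativelyCurved (g : RMetric E M) : Prop :=
  ∀ X Y : Π p : M, TangentSpace 𝓘(ℝ, E) p, CMDiff ∞ (T% X) → CMDiff ∞ (T% Y) →
    ∀ x : M, 0 ≤ unnormalizedSectionalCurvature g X Y x

set_option synthInstance.maxHeartbeats 200000 in
/-- The rescaled metric `c g`, for `c > 0`. -/
def scale (c : ℝ) (hc : 0 < c) (g : RMetric E M) : RMetric E M where
  inner x := c • g.inner x
  symm x v w := by
    simp [g.symm x v w]
  pos x v hv := by
    simpa using mul_pos hc (g.pos x v hv)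
  isVonNBounded x := by
    have h := (g.isVonNBounded x).image
      ((Real.sqrt c)⁻¹ • ContinuousLinearMap.id ℝ (TangentSpace 𝓘(ℝ, E) x))
    refine h.subset fun (v : TangentSpace 𝓘(ℝ, E) x) hv ↦
      (Set.mem_image _ _ _).2 ⟨Real.sqrt c • v, ?_, ?_⟩
    · have hs : Real.sqrt c * Real.sqrt c = c := Real.mul_self_sqrt hc.le
      have hv' : c * g.inner x v v < 1 := by simpa using hv
      simpa [← mul_assoc, hs] using hv'
    · have hs : Real.sqrt c ≠ 0 := (Real.sqrt_pos.2 hc).ne'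
      simp [smul_smul, mul_inv_cancel₀ hs]
  contMDiff := g.contMDiff.const_smul_section

end Manifold

/-! ### Left-invariant metrics on a Lie group and inverse-linear paths -/

section LieGroup

variable {E : Type*} [NormedAddCommGroup E] [NormedSpace ℝ E] [FiniteDimensional ℝ E]
  {G : Type*} [TopologicalSpace G] [ChartedSpace E G] [Group G] [LieGroup 𝓘(ℝ, E) ∞ G]

/-- All left translations are isometries. -/
def IsLeftInvariant (g : RMetric E G) : Prop :=
  ∀ (a x : G) (v w : TangentSpace 𝓘(ℝ, E) x),
    g.inner (a * x) (mfderiv% (fun y : G ↦ a * y) x v) (mfderiv% (fun y : G ↦ a * y) x w) =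
      g.inner x v w

/-- All right translations are isometries. -/
def IsRightInvariant (g : RMetric E G) : Prop :=
  ∀ (a x : G) (v w : TangentSpace 𝓘(ℝ, E) x),
    g.inner (x * a) (mfderiv% (fun y : G ↦ y * a) x v) (mfderiv% (fun y : G ↦ y * a) x w) =
      g.inner x v w

/-- All left and right translations are isometries. -/
def IsBiInvariant (g : RMetric E G) : Prop :=
  IsLeftInvariant g ∧ IsRightInvariant g

variable (E G) in
/-- Linear endomorphisms of the Lie algebra of `G`. -/
abbrev LieEnd : Type _ :=
  GroupLieAlgebra 𝓘(ℝ, E) G →ₗ[ℝ] GroupLieAlgebra 𝓘(ℝ, E) G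

/-- `Φ` is the matrix of the left-invariant metric `h` with respect to `h₀`:
`h(X, Y) = h₀(Φ X, Y)` on the Lie algebra. -/
def IsMatrixOf (h₀ h : RMetric E G) (Φ : LieEnd E G) : Prop :=
  ∀ X Y : GroupLieAlgebra 𝓘(ℝ, E) G, h.inner 1 X Y = h₀.inner 1 (Φ X) Y

/-- The endomorphism `Φ_t = (I - t Ψ)⁻¹`; it is only used where `I - t Ψ` is invertible. -/
def inverseLinear (Ψ : LieEnd E G) (t : ℝ) : LieEnd E G :=
  Ring.inverse (1 - t • Ψ)

/-- `k` is the metric `h_t` at time `t` of the inverse-linear path `Φ_t = (I - t Ψ)⁻¹`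
starting at `h₀`. (There is at most one such `k`, and there is one if and only if `Φ_t` is
defined and is positive definite and self-adjoint with respect to `h₀`.) -/
def IsMetricAtTime (h₀ : RMetric E G) (Ψ : LieEnd E G) (t : ℝ) (k : RMetric E G) : Prop :=
  IsLeftInvariant k ∧ IsUnit (1 - t • Ψ) ∧ IsMatrixOf h₀ k (inverseLinear Ψ t)

/-- `κ(t)`: the unnormalized sectional curvature of `Φ_t⁻¹ X` and `Φ_t⁻¹ Y` with respect to
`k = h_t`, where `Φ_t⁻¹ = I - t Ψ`. Elements of the Lie algebra are regarded as left-invariant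
vector fields, and the curvature is evaluated at the identity. -/
def kappa (k : RMetric E G) (Ψ : LieEnd E G) (X Y : GroupLieAlgebra 𝓘(ℝ, E) G) (t : ℝ) : ℝ :=
  unnormalizedSectionalCurvature k
    (mulInvariantVectorField ((1 - t • Ψ) X)) (mulInvariantVectorField ((1 - t • Ψ) Y)) 1

/-- `κ` is defined at `t`, and `κ(t) ≥ 0`. -/
def KappaNonneg (h₀ : RMetric E G) (Ψ : LieEnd E G) (X Y : GroupLieAlgebra 𝓘(ℝ, E) G)
    (t : ℝ) : Prop :=
  ∃ k : RMetric E G, IsMetricAtTime h₀ Ψ t k ∧ 0 ≤ kappa k Ψ X Y t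

/-- The inverse-linear path `(I - t Ψ)⁻¹` is infinitesimally nonnegative. -/
def IsInfinitesimallyNonneg (h₀ : RMetric E G) (Ψ : LieEnd E G) : Prop :=
  ∀ X Y : GroupLieAlgebra 𝓘(ℝ, E) G, ∃ ε > 0, ∀ t ∈ Set.Ico (0 : ℝ) ε, KappaNonneg h₀ Ψ X Y t

/-- The inverse-linear path `(I - t Ψ)⁻¹` is locally nonnegative. -/
def IsLocallyNonneg (h₀ : RMetric E G) (Ψ : LieEnd E G) : Prop :=
  ∃ ε > 0, ∀ X Y : GroupLieAlgebra 𝓘(ℝ, E) G, ∀ t ∈ Set.Ico (0 : ℝ) ε, KappaNonneg h₀ Ψ X Y t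

/-- The inverse-linear path `(I - t Ψ)⁻¹` is nonnegative: `h_t` is nonnegatively curved
for `0 ≤ t ≤ 1`. -/
def IsNonneg (h₀ : RMetric E G) (Ψ : LieEnd E G) : Prop :=
  ∀ t ∈ Set.Icc (0 : ℝ) 1, ∃ k : RMetric E G, IsMetricAtTime h₀ Ψ t k ∧ IsNonnegativelyCurved k

instance : FiniteDimensional ℝ (GroupLieAlgebra 𝓘(ℝ, E) G) :=
  inferInstanceAs (FiniteDimensional ℝ E)

/-- There is exactly one inverse-linear path from `h₀` to `h`, that is, exactly one `Ψ` for which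
`Φ_1 = (I - Ψ)⁻¹` is defined and is the matrix of `h` with respect to `h₀`. -/
theorem existsUnique_path (h₀ h : RMetric E G) :
    ∃! Ψ : LieEnd E G, IsUnit (1 - (1 : ℝ) • Ψ) ∧ IsMatrixOf h₀ h (inverseLinear Ψ 1) := by
  -- the isomorphism of the Lie algebra with its dual given by a metric
  have key : ∀ g : RMetric E G,
      ∃ e : GroupLieAlgebra 𝓘(ℝ, E) G ≃ₗ[ℝ] Module.Dual ℝ (GroupLieAlgebra 𝓘(ℝ, E) G),
        ∀ X Y, e X Y = g.inner 1 X Y := by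
    intro g
    let f : GroupLieAlgebra 𝓘(ℝ, E) G →ₗ[ℝ] Module.Dual ℝ (GroupLieAlgebra 𝓘(ℝ, E) G) :=
      LinearMap.mk₂ ℝ (fun X Y ↦ g.inner 1 X Y) (by simp) (by simp) (by simp) (by simp)
    have hf : Function.Injective f := by
      rw [injective_iff_map_eq_zero]
      intro X hX
      by_contra hne
      have h1 : g.inner 1 X X = 0 := congrArg (fun l ↦ l X) hX
      exact (g.pos 1 X hne).ne' h1
    exact ⟨LinearEquiv.ofInjectiveOfFinrankEq f hf Subspace.dual_finrank_eq.symm, fun X Y ↦ rfl⟩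
  obtain ⟨e₀, he₀⟩ := key h₀
  obtain ⟨e, he⟩ := key h
  let P : GroupLieAlgebra 𝓘(ℝ, E) G ≃ₗ[ℝ] GroupLieAlgebra 𝓘(ℝ, E) G := e.trans e₀.symm
  have hP : ∀ Φ : LieEnd E G, IsMatrixOf h₀ h Φ ↔ Φ = P := by
    intro Φ
    constructor
    · intro hΦ
      ext X
      apply e₀.injective
      ext Y
      have h2 := hΦ X Y
      simp [P, he₀, he, h2]
    · rintro rfl X Y
      simp [P, ← he₀, ← he]
  let u : (LieEnd E G)ˣ := LinearMap.GeneralLinearGroup.ofLinearEquiv P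
  have hu : (u : LieEnd E G) = P := rfl
  refine ⟨1 - ((u⁻¹ : (LieEnd E G)ˣ) : LieEnd E G), ⟨?_, ?_⟩, ?_⟩
  · rw [one_smul, sub_sub_cancel]
    exact (u⁻¹).isUnit
  · rw [hP, inverseLinear, one_smul, sub_sub_cancel, Ring.inverse_unit, inv_inv, hu]
  · rintro Ψ ⟨⟨w, hw⟩, hΨ⟩
    rw [hP, inverseLinear, ← hw, Ring.inverse_unit, ← hu] at hΨ
    have h3 : w = u⁻¹ := by
      rw [← Units.ext hΨ, inv_inv]
    rw [← h3, hw, one_smul, sub_sub_cancel]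

/-- The endomorphism `Ψ` for which `Φ_t = (I - t Ψ)⁻¹` is the unique inverse-linear path
from `h₀` to `h`. -/
def pathTo (h₀ h : RMetric E G) : LieEnd E G :=
  (existsUnique_path h₀ h).choose

end LieGroup

end LeftInvariantCurvature

end

/-!
Let `Φ` be the matrix of `h` with respect to `h₀`. The inverse-linear path from `h₀` to `h` has
`Φ_s⁻¹ = (1 - s) I + s Φ⁻¹`. The matrix of `h` with respect to `c h₀` is `c⁻¹ Φ`, so the
inverse-linear path from `c h₀` to `h` has `Φ'_t⁻¹ = (1 - t) I + t c Φ⁻¹`. With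
`b = 1 - t + t c` and `s = t c / b` this says `Φ'_t⁻¹ = b Φ_s⁻¹`
(`one_sub_smul_pathTo_scale`), so that `h'_t = (c / b) h_s` (`IsMetricAtTime.scale`). The two paths
thus agree up to rescaling and the reparametrization `t ↦ s`, which maps `[0, 1]` into itself and
tends to `0` with `t`.

Rescaling a metric by a positive constant keeps its Levi-Civita connection and multiplies the
unnormalized sectional curvature by that constant; this settles nonnegative paths. For `κ` the
arguments of the curvature change too, from `Φ_s⁻¹ X` to `b Φ_s⁻¹ X`, and `κ'(t) = (c / b) b⁴ κ(s)`
(`KappaNonneg.scale`) by homogeneity of the curvature on left-invariant fields.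

Homogeneity needs an argument because a covariant derivative is linear only on differentiable
sections, so one has to know that `∇_U V` is differentiable. For a left-invariant metric and
left-invariant `U`, `V` the Koszul formula shows that `∇_U V` is itself left-invariant
(`IsLeftInvariant.covariantDerivative_invariant`).

All of this gives one implication for every `c`. The converse is the same implication for the
initial metric `c h₀` and the factor `c⁻¹`.
-/

open Bundle VectorField
open scoped Manifold ContDiff
noncomputable section
namespace LeftInvariantCurvature

/-! ### Rescaling metrics -/

section Manifold

variable {E : Type*} [NormedAddCommGroup E] [NormedSpace ℝ E] [FiniteDimensional ℝ E]
  {M : Type*} [TopologicalSpace M] [ChartedSpace E M] [IsManifold 𝓘(ℝ, E) ∞ M]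

omit [FiniteDimensional ℝ E] in
@[ext]
theorem RMetric.ext {g g' : RMetric E M} (h : ∀ x, g.inner x = g'.inner x) : g = g' := by
  cases g; cases g'
  congr
  exact funext h

omit [FiniteDimensional ℝ E] in
@[simp]
theorem scale_inner (c : ℝ) (hc : 0 < c) (g : RMetric E M) (x : M)
    (v w : TangentSpace 𝓘(ℝ, E) x) : (scale c hc g).inner x v w = c * g.inner x v w := rfl

omit [FiniteDimensional ℝ E] in
theorem scale_scale_inv (c : ℝ) (hc : 0 < c) (g : RMetric E M) :
    scale c⁻¹ (inv_pos.2 hc) (scale c hc g) = g :=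
  RMetric.ext fun x ↦ by
    ext v w
    simp only [scale_inner]
    field_simp

omit [FiniteDimensional ℝ E] [IsManifold 𝓘(ℝ, E) ∞ M] in
/-- No differentiability is needed: where `f` is not differentiable, both sides are zero. -/
theorem mvfderiv_const_mul {c : ℝ} (hc : c ≠ 0) (f : M → ℝ) (x : M) :
    d% (fun p ↦ c * f p) x = c • d% f x := by
  by_cases hf : MDiffAt f x
  · have := const_smul_mfderiv hf c
    ext v
    exact congr($this v)
  · have hf' : ¬ MDiffAt (fun p ↦ c * f p) x := by
      intro h
      apply hf
      have := h.const_smul c⁻¹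
      have e : (c⁻¹ • fun p ↦ c * f p) = f := by
        ext p; simp [hc]
      rwa [e] at this
    ext v
    simp [mvfderiv, mfderiv_zero_of_not_mdifferentiableAt hf, mfderiv_zero_of_not_mdifferentiableAt hf']

theorem IsLeviCivita.scale {g : RMetric E M} {D : Connection E M} (h : IsLeviCivita g D)
    (c : ℝ) (hc : 0 < c) : IsLeviCivita (scale c hc g) D := by
  refine ⟨h.1, fun x v Y Z hY hZ ↦ ?_⟩
  simp only [scale_inner]
  rw [mvfderiv_const_mul hc.ne']
  have := h.2 x v Y Z hY hZ
  simp [this, mul_add]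

theorem isLeviCivita_scale (c : ℝ) (hc : 0 < c) (g : RMetric E M) :
    IsLeviCivita (scale c hc g) = IsLeviCivita g := by
  ext D
  refine ⟨fun h ↦ ?_, fun h ↦ h.scale c hc⟩
  simpa only [scale_scale_inv] using h.scale c⁻¹ (inv_pos.2 hc)

/-- The metrics `c g` and `g` have the same set of Levi-Civita connections, hence the same chosen
one, so this holds for arbitrary `X` and `Y`. -/
theorem unnormalizedSectionalCurvature_scale (c : ℝ) (hc : 0 < c) (g : RMetric E M)
    (X Y : Π p : M, TangentSpace 𝓘(ℝ, E) p) (x : M) :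
    unnormalizedSectionalCurvature (scale c hc g) X Y x =
      c * unnormalizedSectionalCurvature g X Y x := by
  have e := isLeviCivita_scale c hc g
  unfold unnormalizedSectionalCurvature
  generalize IsLeviCivita (LeftInvariantCurvature.scale c hc g) = P at e
  subst e
  split_ifs <;> simp

theorem IsNonnegativelyCurved.scale {g : RMetric E M} (h : IsNonnegativelyCurved g)
    (c : ℝ) (hc : 0 < c) : IsNonnegativelyCurved (scale c hc g) := by
  intro X Y hX hY x
  rw [unnormalizedSectionalCurvature_scale]
  exact mul_nonneg hc.le (h X Y hX hY x)

end Manifold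

/-! ### The Levi-Civita connection of a left-invariant metric -/

section LieGroup

variable {E : Type*} [NormedAddCommGroup E] [NormedSpace ℝ E] [FiniteDimensional ℝ E]
  {G : Type*} [TopologicalSpace G] [ChartedSpace E G] [Group G] [LieGroup 𝓘(ℝ, E) ∞ G]

omit [FiniteDimensional ℝ E] in
variable (E G) in
theorem lieGroup_minSmoothness : LieGroup 𝓘(ℝ, E) (minSmoothness ℝ 3) G := by
  rw [minSmoothness_of_isRCLikeNormedField]
  infer_instance

omit [FiniteDimensional ℝ E] in
theorem mdifferentiableAt_leftInvariantField (v : GroupLieAlgebra 𝓘(ℝ, E) G) (x : G) :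
    MDiffAt (T% (mulInvariantVectorField v)) x := by
  have := lieGroup_minSmoothness E G
  exact mdifferentiableAt_mulInvariantVectorField v

omit [FiniteDimensional ℝ E] in
theorem IsLeftInvariant.inner_mulInvariantVectorField {g : RMetric E G} (hg : IsLeftInvariant g)
    (x : G) (v w : GroupLieAlgebra 𝓘(ℝ, E) G) :
    g.inner x (mulInvariantVectorField v x) (mulInvariantVectorField w x) = g.inner 1 v w := by
  -- the left-hand side lives at `x`, left invariance gives the identity at `x * 1`
  have transport : ∀ (y : G) (_ : y = x * 1) (A B : E),
      g.inner y (A : TangentSpace 𝓘(ℝ, E) y) (B : TangentSpace 𝓘(ℝ, E) y) =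
        g.inner (x * 1) (A : TangentSpace 𝓘(ℝ, E) (x * 1)) (B : TangentSpace 𝓘(ℝ, E) (x * 1)) := by
    rintro _ rfl A B
    rfl
  exact (transport x (mul_one x).symm _ _).trans (hg x 1 v w)

/-- Every tangent vector extends to a left-invariant field. Left translations are isometries, so
their derivatives are injective, and the dimension is finite. -/
theorem IsLeftInvariant.exists_mulInvariantVectorField_eq {g : RMetric E G}
    (hg : IsLeftInvariant g) {x : G} (v : TangentSpace 𝓘(ℝ, E) x) :
    ∃ w : GroupLieAlgebra 𝓘(ℝ, E) G, mulInvariantVectorField w x = v := by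
  let L : E →ₗ[ℝ] E := (mfderiv% (fun y : G ↦ x * y) (1 : G) : E →L[ℝ] E).toLinearMap
  have hL : ∀ w : GroupLieAlgebra 𝓘(ℝ, E) G, L w = mulInvariantVectorField w x := fun _ ↦ rfl
  have hinj : Function.Injective L := by
    rw [injective_iff_map_eq_zero]
    intro w hw
    by_contra hne
    have h1 := hg.inner_mulInvariantVectorField x w w
    rw [← hL w, hw] at h1
    have h2 := g.pos 1 w hne
    have h3 : g.inner x (0 : TangentSpace 𝓘(ℝ, E) x) (0 : TangentSpace 𝓘(ℝ, E) x) = 0 := by simp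
    exact h2.ne' (h1.symm.trans h3)
  exact LinearMap.injective_iff_surjective.1 hinj v

/-- For left-invariant fields `U`, `V` and a left-invariant metric, `∇_U V` is left-invariant: by
the Koszul formula its inner product with any left-invariant field is constant. -/
theorem IsLeftInvariant.covariantDerivative_invariant {g : RMetric E G}
    (hg : IsLeftInvariant g) {D : Connection E G} (hD : IsLeviCivita g D)
    (u v : GroupLieAlgebra 𝓘(ℝ, E) G) :
    ∃ w : GroupLieAlgebra 𝓘(ℝ, E) G,
      (fun p ↦ D (mulInvariantVectorField v) p (mulInvariantVectorField u p)) =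
        mulInvariantVectorField w := by
  have := lieGroup_minSmoothness E G
  have : CompleteSpace E := FiniteDimensional.complete ℝ E
  have compat : ∀ (x : G) (a b c : GroupLieAlgebra 𝓘(ℝ, E) G),
      g.inner x (D (mulInvariantVectorField b) x (mulInvariantVectorField a x))
          (mulInvariantVectorField c x) +
        g.inner x (D (mulInvariantVectorField c) x (mulInvariantVectorField a x))
          (mulInvariantVectorField b x) = 0 := by
    intro x a b c
    have h := hD.2 x (mulInvariantVectorField a x) _ _ (mdifferentiableAt_leftInvariantField b x)
      (mdifferentiableAt_leftInvariantField c x)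
    simp only [hg.inner_mulInvariantVectorField] at h
    rw [g.symm x (D (mulInvariantVectorField c) x (mulInvariantVectorField a x)), ← h]
    -- the inner product of two left-invariant fields is constant
    simp [mvfderiv]
  have torsion : ∀ (x : G) (a b : GroupLieAlgebra 𝓘(ℝ, E) G),
      D (mulInvariantVectorField b) x (mulInvariantVectorField a x) -
        D (mulInvariantVectorField a) x (mulInvariantVectorField b x) =
          mulInvariantVectorField ⁅a, b⁆ x := by
    intro x a b
    rw [D.torsion_eq_zero_iff.1 hD.1 (mdifferentiableAt_leftInvariantField a x)
      (mdifferentiableAt_leftInvariantField b x), GroupLieAlgebra.bracket_def,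
      mulInvariantVector_mlieBracket]
  have koszul : ∀ (x : G) (c : GroupLieAlgebra 𝓘(ℝ, E) G),
      2 * g.inner x (D (mulInvariantVectorField v) x (mulInvariantVectorField u x))
          (mulInvariantVectorField c x) =
        g.inner 1 ⁅u, v⁆ c - g.inner 1 ⁅v, c⁆ u + g.inner 1 ⁅c, u⁆ v := by
    intro x c
    have t : ∀ a b d : GroupLieAlgebra 𝓘(ℝ, E) G,
        g.inner x (D (mulInvariantVectorField b) x (mulInvariantVectorField a x))
            (mulInvariantVectorField d x) -
          g.inner x (D (mulInvariantVectorField a) x (mulInvariantVectorField b x))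
            (mulInvariantVectorField d x) = g.inner 1 ⁅a, b⁆ d := by
      intro a b d
      rw [← hg.inner_mulInvariantVectorField x, ← torsion]
      simp
    linarith [t u v c, t v c u, t c u v, compat x u v c, compat x v c u, compat x c u v]
  obtain ⟨w, hw⟩ := hg.exists_mulInvariantVectorField_eq
    (D (mulInvariantVectorField v) 1 (mulInvariantVectorField u 1))
  refine ⟨w, funext fun x ↦ ?_⟩
  have orth : ∀ c : GroupLieAlgebra 𝓘(ℝ, E) G,
      g.inner x (D (mulInvariantVectorField v) x (mulInvariantVectorField u x) -
        mulInvariantVectorField w x) (mulInvariantVectorField c x) = 0 := by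
    intro c
    have h1 := koszul 1 c
    rw [← hw, hg.inner_mulInvariantVectorField] at h1
    have h2 := koszul x c
    have h3 := hg.inner_mulInvariantVectorField x w c
    simp only [map_sub, sub_apply]
    linarith
  obtain ⟨c, hc⟩ := hg.exists_mulInvariantVectorField_eq
    (D (mulInvariantVectorField v) x (mulInvariantVectorField u x) - mulInvariantVectorField w x)
  by_contra hne
  have h := orth c
  rw [hc] at h
  exact (g.pos x _ (sub_ne_zero.2 hne)).ne' h

/-- Homogeneity in the first derivative is part of the definition of a covariant derivative. In the
second one it holds because `∇_U V` is left-invariant, hence differentiable. -/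
theorem IsLeftInvariant.curvatureOperator_smul {g : RMetric E G}
    (hg : IsLeftInvariant g) {D : Connection E G} (hD : IsLeviCivita g D) (b : ℝ)
    (u v : GroupLieAlgebra 𝓘(ℝ, E) G) (x : G) :
    curvatureOperator D (mulInvariantVectorField (b • u)) (mulInvariantVectorField (b • v))
        (mulInvariantVectorField (b • v)) x =
      b ^ 3 • curvatureOperator D (mulInvariantVectorField u) (mulInvariantVectorField v)
        (mulInvariantVectorField v) x := by
  have := lieGroup_minSmoothness E G
  have : CompleteSpace E := FiniteDimensional.complete ℝ E
  have hsmul : ∀ (a : ℝ) (w : GroupLieAlgebra 𝓘(ℝ, E) G) (p : G),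
      D (mulInvariantVectorField (a • w)) p = a • D (mulInvariantVectorField w) p := by
    intro a w p
    rw [mulInvariantVectorField_smul]
    exact D.isCovariantDerivativeOn.smul_const a (mdifferentiableAt_leftInvariantField w p)
  have hsecond : ∀ w : GroupLieAlgebra 𝓘(ℝ, E) G,
      D (fun p ↦ D (mulInvariantVectorField (b • v)) p (mulInvariantVectorField (b • w) p)) x =
        b ^ 2 • D (fun p ↦ D (mulInvariantVectorField v) p (mulInvariantVectorField w p)) x := by
    intro w
    obtain ⟨z, hz⟩ := hg.covariantDerivative_invariant hD w v
    have e : (fun p ↦ D (mulInvariantVectorField (b • v)) p (mulInvariantVectorField (b • w) p)) =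
        mulInvariantVectorField (b ^ 2 • z) := by
      funext p
      rw [hsmul, mulInvariantVectorField_smul, mulInvariantVectorField_smul, ← hz]
      simp [smul_smul, sq]
    rw [e, hz, hsmul]
  simp only [curvatureOperator, hsecond]
  rw [hsmul]
  rw [← mulInvariantVector_mlieBracket (b • u), ← GroupLieAlgebra.bracket_def,
    ← mulInvariantVector_mlieBracket u, ← GroupLieAlgebra.bracket_def, smul_lie, lie_smul]
  simp only [mulInvariantVectorField_smul, Pi.smul_apply, map_smul, smul_apply]
  module

theorem IsLeftInvariant.unnormalizedSectionalCurvature_smul {g : RMetric E G}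
    (hg : IsLeftInvariant g) (b : ℝ) (u v : GroupLieAlgebra 𝓘(ℝ, E) G) (x : G) :
    unnormalizedSectionalCurvature g (mulInvariantVectorField (b • u))
        (mulInvariantVectorField (b • v)) x =
      b ^ 4 * unnormalizedSectionalCurvature g (mulInvariantVectorField u)
        (mulInvariantVectorField v) x := by
  unfold unnormalizedSectionalCurvature
  split_ifs with h
  · rw [hg.curvatureOperator_smul h.choose_spec, mulInvariantVectorField_smul]
    simp only [Pi.smul_apply, map_smul, smul_apply, smul_eq_mul]
    ring
  · simp

/-! ### Rescaling the initial metric of an inverse-linear path -/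

theorem ringInverse_smul_of_ne_zero {K A : Type*} [Field K] [Ring A] [Algebra K A] {b : K}
    (hb : b ≠ 0) (a : A) : Ring.inverse (b • a) = b⁻¹ • Ring.inverse a := by
  by_cases ha : IsUnit a
  · obtain ⟨u, rfl⟩ := ha
    have e : b • (u : A) = ((Units.mk0 b hb • u : Aˣ) : A) := rfl
    rw [e, Ring.inverse_unit, Ring.inverse_unit]
    rfl
  · have ha' : ¬ IsUnit (b • a) := fun h ↦ ha ((isUnit_smul_iff (Units.mk0 b hb) a).1 h)
    rw [Ring.inverse_non_unit _ ha, Ring.inverse_non_unit _ ha', smul_zero]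

/-- In terms of `1 - Ψ`, the inverse of the matrix of `h`: it is multiplied by `c` when the
reference metric is. -/
theorem pathTo_scale (h₀ h : RMetric E G) (c : ℝ) (hc : 0 < c) :
    pathTo (scale c hc h₀) h = 1 - c • (1 - pathTo h₀ h) := by
  obtain ⟨⟨hu, hm⟩, -⟩ := (existsUnique_path h₀ h).choose_spec
  change IsUnit (1 - (1 : ℝ) • pathTo h₀ h) at hu
  change IsMatrixOf h₀ h (inverseLinear (pathTo h₀ h) 1) at hm
  refine ((existsUnique_path (scale c hc h₀) h).choose_spec.2 _ ⟨?_, ?_⟩).symm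
  · rw [one_smul, sub_sub_cancel]
    rw [one_smul] at hu
    exact hu.smul (Units.mk0 c hc.ne')
  · intro X Y
    rw [hm X Y, inverseLinear, inverseLinear, one_smul, one_smul, sub_sub_cancel,
      ringInverse_smul_of_ne_zero hc.ne']
    simp [hc.ne']

omit [FiniteDimensional ℝ E] in
/-- If `Φ'_t⁻¹ = b Φ_s⁻¹`, then the metric at time `t` of the path `Φ'` from `c h₀` is `c / b` times
the metric at time `s` of the path `Φ` from `h₀`. -/
theorem IsMetricAtTime.scale {h₀ k : RMetric E G} {Ψ Ψ' : LieEnd E G} {s t b : ℝ}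
    (hk : IsMetricAtTime h₀ Ψ s k) (c : ℝ) (hc : 0 < c) (hb : 0 < b)
    (hΨ : 1 - t • Ψ' = b • (1 - s • Ψ)) :
    IsMetricAtTime (scale c hc h₀) Ψ' t (scale (c / b) (div_pos hc hb) k) := by
  refine ⟨fun a x v w ↦ ?_, ?_, fun X Y ↦ ?_⟩
  · simp [hk.1 a x v w]
  · rw [hΨ]
    exact hk.2.1.smul (Units.mk0 b hb.ne')
  · rw [inverseLinear, hΨ, ringInverse_smul_of_ne_zero hb.ne']
    have := hk.2.2 X Y
    rw [inverseLinear] at this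
    simp [this]
    ring

theorem KappaNonneg.scale {h₀ : RMetric E G} {Ψ Ψ' : LieEnd E G} {s t b : ℝ}
    {X Y : GroupLieAlgebra 𝓘(ℝ, E) G} (hκ : KappaNonneg h₀ Ψ X Y s) (c : ℝ) (hc : 0 < c)
    (hb : 0 < b) (hΨ : 1 - t • Ψ' = b • (1 - s • Ψ)) :
    KappaNonneg (scale c hc h₀) Ψ' X Y t := by
  obtain ⟨k, hk, hk0⟩ := hκ
  refine ⟨_, hk.scale c hc hb hΨ, ?_⟩
  rw [kappa, hΨ, unnormalizedSectionalCurvature_scale, LinearMap.smul_apply, LinearMap.smul_apply,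
    hk.1.unnormalizedSectionalCurvature_smul]
  unfold kappa at hk0
  positivity

theorem reparam_pos {c t : ℝ} (hc : 0 < c) (ht : t ∈ Set.Icc (0 : ℝ) 1) :
    0 < 1 - t + t * c := by
  rcases ht.1.eq_or_lt with rfl | h
  · simp
  · nlinarith [ht.2, mul_pos h hc]

theorem one_sub_smul_pathTo_scale (h₀ h : RMetric E G) {c t : ℝ} (hc : 0 < c)
    (ht : t ∈ Set.Icc (0 : ℝ) 1) :
    1 - t • pathTo (scale c hc h₀) h =
      (1 - t + t * c) • (1 - (t * c / (1 - t + t * c)) • pathTo h₀ h) := by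
  rw [pathTo_scale, smul_sub (1 - t + t * c), smul_smul,
    mul_div_cancel₀ _ (reparam_pos hc ht).ne']
  module

theorem IsNonneg.scale {h₀ h : RMetric E G} (H : IsNonneg h₀ (pathTo h₀ h)) (c : ℝ) (hc : 0 < c) :
    IsNonneg (scale c hc h₀) (pathTo (scale c hc h₀) h) := by
  intro t ht
  have hb := reparam_pos hc ht
  obtain ⟨k, hk, hk0⟩ := H (t * c / (1 - t + t * c))
    ⟨div_nonneg (mul_nonneg ht.1 hc.le) hb.le, (div_le_one hb).2 (by linarith [ht.2])⟩
  exact ⟨_, hk.scale c hc hb (one_sub_smul_pathTo_scale h₀ h hc ht), hk0.scale _ _⟩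

/-- The reparametrization `t ↦ t c / (1 - t + t c)` is small near zero. -/
theorem exists_reparam_lt {c ε : ℝ} (hc : 0 < c) (hε : 0 < ε) :
    ∃ δ > 0, ∀ t ∈ Set.Ico (0 : ℝ) δ,
      t ∈ Set.Icc (0 : ℝ) 1 ∧ t * c / (1 - t + t * c) ∈ Set.Ico (0 : ℝ) ε := by
  -- `min 1 c` is a lower bound of the denominator, a convex combination of `1` and `c`
  refine ⟨min 1 (ε * min 1 c / c), by positivity, fun t ⟨ht0, ht⟩ ↦ ?_⟩
  have ht1 : t < 1 := ht.trans_le (min_le_left _ _)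
  have ht2 : t * c < ε * min 1 c := (lt_div_iff₀ hc).1 (ht.trans_le (min_le_right _ _))
  have hb := reparam_pos hc ⟨ht0, ht1.le⟩
  refine ⟨⟨ht0, ht1.le⟩, div_nonneg (mul_nonneg ht0 hc.le) hb.le, (div_lt_iff₀ hb).2 ?_⟩
  have hm : min 1 c ≤ 1 - t + t * c := by
    nlinarith [min_le_left 1 c, min_le_right 1 c]
  exact ht2.trans_le (by gcongr)

theorem IsLocallyNonneg.scale {h₀ h : RMetric E G} (H : IsLocallyNonneg h₀ (pathTo h₀ h))
    (c : ℝ) (hc : 0 < c) : IsLocallyNonneg (scale c hc h₀) (pathTo (scale c hc h₀) h) := by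
  obtain ⟨ε, hε, H⟩ := H
  obtain ⟨δ, hδ, hδε⟩ := exists_reparam_lt hc hε
  refine ⟨δ, hδ, fun X Y t ht ↦ ?_⟩
  obtain ⟨ht1, hs⟩ := hδε t ht
  exact (H X Y _ hs).scale c hc (reparam_pos hc ht1) (one_sub_smul_pathTo_scale h₀ h hc ht1)

theorem IsInfinitesimallyNonneg.scale {h₀ h : RMetric E G}
    (H : IsInfinitesimallyNonneg h₀ (pathTo h₀ h)) (c : ℝ) (hc : 0 < c) :
    IsInfinitesimallyNonneg (scale c hc h₀) (pathTo (scale c hc h₀) h) := by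
  intro X Y
  obtain ⟨ε, hε, H⟩ := H X Y
  obtain ⟨δ, hδ, hδε⟩ := exists_reparam_lt hc hε
  refine ⟨δ, hδ, fun t ht ↦ ?_⟩
  obtain ⟨ht1, hs⟩ := hδε t ht
  exact (H _ hs).scale c hc (reparam_pos hc ht1) (one_sub_smul_pathTo_scale h₀ h hc ht1)

end LieGroup

end LeftInvariantCurvature

end

open LeftInvariantCurvature in
theorem theorem6p1
    {E : Type*} [NormedAddCommGroup E] [NormedSpace ℝ E] [FiniteDimensional ℝ E]
    {G : Type*} [TopologicalSpace G] [T2Space G] [CompactSpace G] [ChartedSpace E G]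
    [Group G] [LieGroup 𝓘(ℝ, E) ∞ G]
    (h₀ : RMetric E G) (hh₀ : IsBiInvariant h₀)
    (h : RMetric E G) (hh : IsLeftInvariant h)
    (c : ℝ) (hc : 0 < c) :
    (IsNonneg h₀ (pathTo h₀ h) ↔
      IsNonneg (scale c hc h₀) (pathTo (scale c hc h₀) h)) ∧
    (IsLocallyNonneg h₀ (pathTo h₀ h) ↔
      IsLocallyNonneg (scale c hc h₀) (pathTo (scale c hc h₀) h)) ∧
    (IsInfinitesimallyNonneg h₀ (pathTo h₀ h) ↔
      IsInfinitesimallyNonneg (scale c hc h₀) (pathTo (scale c hc h₀) h)) := by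
  refine ⟨⟨fun H ↦ H.scale c hc, fun H ↦ ?_⟩, ⟨fun H ↦ H.scale c hc, fun H ↦ ?_⟩,
    ⟨fun H ↦ H.scale c hc, fun H ↦ ?_⟩⟩
  all_goals simpa only [scale_scale_inv] using H.scale c⁻¹ (inv_pos.2 hc)
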